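/- A \emph{Bell scenario} consists of finite input alphabets $\mathcal X,\mathcal Y$ (non-empty) and finite output alphabets $\mathcal A,\mathcal B$. A \emph{box} in it is a family of probability distributions $P(a,b|x,y)$ that is no-signalling: $\sum_b P(a,b|x,y)=:P(a|x)$ does not depend on $y$ and $\sum_a P(a,b|x,y)=:P(b|y)$ does not depend on $x$. \textbf{Symbolic projectors.} For each Bell scenario take the real unital algebra generated by symbols $E^x_a$ and $F^y_b$ with the relations $(E^x_a)^2=E^x_a$, $(F^y_b)^2=F^y_b$, $E^x_aE^x_{a'}=0$ for $a\neq a'$, $F^y_bF^y_{b'}=0$ for $b\neq b'$, and $E^x_aF^y_b=F^y_bE^x_a$, with the real-linear conjugation $\dagger$ that reverses products and fixes all symbols. Let $A^mB^n$ be the set of all products $E^{x_1}_{a_1}\cdots E^{x_{m'}}_{a_{m'}}F^{y_1}_{b_1}\cdots F^{y_{n'}}_{b_{n'}}$ with $0\le m'\leq m$, $0\le n'\leq n$. Let $\mathcal O$ be a union of sets of the form $A^mB^n$, with $(m,n)$ ranging over a fixed set of pairs of non-negative integers, that contains all $E^x_a$ and all $F^y_b$ (that is, some pair has $m\ge 1$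 and some pair has $n\geq 1$). Let $\overline{\mathcal O}$ be the real span of $\mathcal O$ and $\overline{\mathcal O}^2$ the real span of the products of two elements of $\mathcal O$. A box $P$ is \emph{$\mathcal O$-positive} if there is a linear functional $L:\overline{\mathcal O}^2\to\mathbb R$ with $L(1)=1$, $L(ff^\dagger)\ge 0$ for all $f\in\overline{\mathcal O}$, and $P(a,b|x,y)=L(E^x_aF^y_b)$ for all $a,b,x,y$. Let $\mathcal Q^{\mathcal O}$ be the set of all $\mathcal O$-positive boxes, in all Bell scenarios. For $N\ge1$, the level $\mathcal Q^N$ of the NPA hierarchy is $\mathcal Q^{\mathcal O}$ for $\mathcal O=\bigcup_{m=0}^N A^mB^{N-m}$. \textbf{Wirings.} Let $P_1,\dots,P_n$ be boxes, in possibly different Bell scenarios. A \emph{deterministic adaptive strategy} of Alice is a finite procedure that at each step either announces a result and ends, or chooses a box not used before and an input for her side of it; the choice may depend on the whole history of previous outputs. A \emph{wiring} $\mathcal W_A$ of Alice assigns to each effective input $x$ (from a finite non-empty alphabet) such a strategy, announcing an effective output from a finite alphabet. Wirings $\mathcal W_B$ of Bob are defined likewise. The wired box $P'=\mathcal W_A\otimes\mathcal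 W_B(\bigotimes_i P_i)$ is $$P'(a,b|x,y)=\sum_{\alpha,\beta}\prod_{i=1}^nP_i(\alpha_i,\beta_i),$$ where $\alpha$ (respectively $\beta$) ranges over the possible runs of Alice's strategy for $x$ (of Bob's strategy for $y$) that end by announcing $a$ (respectively $b$); $\alpha_i$, $\beta_i$ are the pairs (input, output) recorded for box $i$; and $P_i(\alpha_i,\beta_i)$ is the probability that box $i$ gives to them: $P_i(a_i,b_i|x_i,y_i)$ if both parties used box $i$, the marginal $P_i(a_i|x_i)$ or $P_i(b_i|y_i)$ if only one did, and $1$ if neither did. A set $\mathcal S$ of boxes is \emph{closed under wirings} if $\mathcal W_A\otimes\mathcal W_B(\bigotimes_iP_i)\in\mathcal S$ for any finite collection of boxes $P_1,\dots,P_n\in\mathcal S$ and any wirings $\mathcal W_A$, $\mathcal W_B$. \textbf{Theorem.} For every set $\mathcal O$ that is a union of sets $A^mB^n$ and contains all $E^x_a$ and all $F^y_b$, the set $\mathcal Q^{\mathcal O}$ is closed under wirings. In particular, for every $N\geq 1$, the level $\mathcal Q^N$ of the NPA hierarchy is closed under wirings. -/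

import Mathlib

open scoped BigOperators Pointwise

namespace Wirings

/-- A bipartite Bell scenario: finite alphabets of inputs `X`, `Y` and outputs `A`, `B` for
Alice and Bob.  Each party has at least one input. -/
structure Scenario where
  X : Type
  Y : Type
  A : Type
  B : Type
  [fintypeX : Fintype X]
  [fintypeY : Fintype Y]
  [fintypeA : Fintype A]
  [fintypeB : Fintype B]
  [decEqX : DecidableEq X]
  [decEqY : DecidableEq Y]
  [decEqA : DecidableEq A]
  [decEqB : DecidableEq B]
  [nonemptyX : Nonempty X]
  [nonemptyY : Nonempty Y]

attribute [instance] Scenario.fintypeX Scenario.fintypeY Scenario.fintypeA Scenario.fintypeB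
  Scenario.decEqX Scenario.decEqY Scenario.decEqA Scenario.decEqB
  Scenario.nonemptyX Scenario.nonemptyY

/-- A table of numbers `P x y a b`, written `P(a,b|x,y)` on paper. -/
abbrev Table (s : Scenario) : Type := s.X → s.Y → s.A → s.B → ℝ

/-- `P(a,b|x,y)` is a no-signalling family of probability distributions (a pair of boxes). -/
structure IsNoSignalling {s : Scenario} (P : Table s) : Prop where
  nonneg : ∀ x y a b, 0 ≤ P x y a b
  sum_eq_one : ∀ x y, ∑ a, ∑ b, P x y a b = 1
  /-- Alice's marginal does not depend on Bob's input. -/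
  alice : ∀ x a y y', ∑ b, P x y a b = ∑ b, P x y' a b
  /-- Bob's marginal does not depend on Alice's input. -/
  bob : ∀ y b x x', ∑ a, P x y a b = ∑ a, P x' y a b

/-! ### Symbolic projectors -/

/-- One symbol for every local event `(x,a)` of Alice and `(y,b)` of Bob. -/
inductive Event (s : Scenario) : Type
  | alice (x : s.X) (a : s.A)
  | bob (y : s.Y) (b : s.B)

/-- The formal relations: the symbols are idempotent, different outcomes of the same measurement
are orthogonal, and Alice's symbols commute with Bob's. -/
inductive EventRel (s : Scenario) :
    FreeAlgebra ℝ (Event s) → FreeAlgebra ℝ (Event s) → Prop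
  | alice_idem (x : s.X) (a : s.A) :
      EventRel s (FreeAlgebra.ι ℝ (.alice x a) * FreeAlgebra.ι ℝ (.alice x a))
        (FreeAlgebra.ι ℝ (.alice x a))
  | bob_idem (y : s.Y) (b : s.B) :
      EventRel s (FreeAlgebra.ι ℝ (.bob y b) * FreeAlgebra.ι ℝ (.bob y b))
        (FreeAlgebra.ι ℝ (.bob y b))
  | alice_orth (x : s.X) (a a' : s.A) (h : a ≠ a') :
      EventRel s (FreeAlgebra.ι ℝ (.alice x a) * FreeAlgebra.ι ℝ (.alice x a')) 0
  | bob_orth (y : s.Y) (b b' : s.B) (h : b ≠ b') :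
      EventRel s (FreeAlgebra.ι ℝ (.bob y b) * FreeAlgebra.ι ℝ (.bob y b')) 0
  | comm (x : s.X) (a : s.A) (y : s.Y) (b : s.B) :
      EventRel s (FreeAlgebra.ι ℝ (.alice x a) * FreeAlgebra.ι ℝ (.bob y b))
        (FreeAlgebra.ι ℝ (.bob y b) * FreeAlgebra.ι ℝ (.alice x a))

/-- The real algebra of formal linear combinations of products of symbolic projectors. -/
abbrev SymAlg (s : Scenario) : Type := RingQuot (EventRel s)

/-- The symbolic projector `E^x_a`. -/
noncomputable def E {s : Scenario} (x : s.X) (a : s.A) : SymAlg s :=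
  RingQuot.mkAlgHom ℝ (EventRel s) (FreeAlgebra.ι ℝ (.alice x a))

/-- The symbolic projector `F^y_b`. -/
noncomputable def F {s : Scenario} (y : s.Y) (b : s.B) : SymAlg s :=
  RingQuot.mkAlgHom ℝ (EventRel s) (FreeAlgebra.ι ℝ (.bob y b))

section Relations

variable {s : Scenario}

theorem E_mul_self (x : s.X) (a : s.A) : E x a * E x a = E x a := by
  simpa [E] using RingQuot.mkAlgHom_rel ℝ (EventRel.alice_idem x a)

theorem F_mul_self (y : s.Y) (b : s.B) : F y b * F y b = F y b := by
  simpa [F] using RingQuot.mkAlgHom_rel ℝ (EventRel.bob_idem y b)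

theorem E_mul_of_ne (x : s.X) {a a' : s.A} (h : a ≠ a') : E x a * E x a' = 0 := by
  simpa [E] using RingQuot.mkAlgHom_rel ℝ (EventRel.alice_orth x a a' h)

theorem F_mul_of_ne (y : s.Y) {b b' : s.B} (h : b ≠ b') : F y b * F y b' = 0 := by
  simpa [F] using RingQuot.mkAlgHom_rel ℝ (EventRel.bob_orth y b b' h)

theorem E_mul_F (x : s.X) (a : s.A) (y : s.Y) (b : s.B) :
    E x a * F y b = F y b * E x a := by
  simpa [E, F] using RingQuot.mkAlgHom_rel ℝ (EventRel.comm x a y b)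

end Relations

/-- The value of the symbols under the formal conjugation (each symbol is self-adjoint), as
elements of the opposite algebra. -/
noncomputable def eventOp (s : Scenario) : Event s → (SymAlg s)ᵐᵒᵖ
  | .alice x a => MulOpposite.op (E x a)
  | .bob y b => MulOpposite.op (F y b)

theorem eventOp_rel (s : Scenario) ⦃u v : FreeAlgebra ℝ (Event s)⦄ (h : EventRel s u v) :
    FreeAlgebra.lift ℝ (eventOp s) u = FreeAlgebra.lift ℝ (eventOp s) v := by
  cases h with
  | alice_idem x a => simp [eventOp, ← MulOpposite.op_mul, E_mul_self]
  | bob_idem y b => simp [eventOp, ← MulOpposite.op_mul, F_mul_self]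
  | alice_orth x a a' h => simp [eventOp, ← MulOpposite.op_mul, E_mul_of_ne x h.symm]
  | bob_orth y b b' h => simp [eventOp, ← MulOpposite.op_mul, F_mul_of_ne y h.symm]
  | comm x a y b => simp [eventOp, ← MulOpposite.op_mul, E_mul_F]

/-- Formal conjugation as an algebra homomorphism into the opposite algebra. -/
noncomputable def adjHom (s : Scenario) : SymAlg s →ₐ[ℝ] (SymAlg s)ᵐᵒᵖ :=
  RingQuot.liftAlgHom ℝ ⟨FreeAlgebra.lift ℝ (eventOp s), eventOp_rel s⟩

/-- Formal conjugation `f ↦ f†`: the real-linear map that reverses products and fixes every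
symbolic projector. -/
noncomputable def adj {s : Scenario} : SymAlg s →ₗ[ℝ] SymAlg s :=
  (MulOpposite.opLinearEquiv ℝ).symm.toLinearMap ∘ₗ (adjHom s).toLinearMap

section Conjugation

variable {s : Scenario}

theorem adj_one : adj (1 : SymAlg s) = 1 := by
  simp [adj]

theorem adj_mul (f g : SymAlg s) : adj (f * g) = adj g * adj f := by
  simp [adj]

theorem adj_E (x : s.X) (a : s.A) : adj (E x a) = E x a := by
  simp [adj, adjHom, E, eventOp]

theorem adj_F (y : s.Y) (b : s.B) : adj (F y b) = F y b := by
  simp [adj, adjHom, F, eventOp]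

theorem E_list_mul_F_list (u : List (s.X × s.A)) (v : List (s.Y × s.B)) :
    (u.map fun p => E p.1 p.2).prod * (v.map fun p => F p.1 p.2).prod =
      (v.map fun p => F p.1 p.2).prod * (u.map fun p => E p.1 p.2).prod := by
  refine Commute.list_prod_left _ _ fun e he => Commute.list_prod_right _ _ fun f hf => ?_
  obtain ⟨p, -, rfl⟩ := List.mem_map.1 he
  obtain ⟨q, -, rfl⟩ := List.mem_map.1 hf
  exact E_mul_F _ _ _ _

theorem adj_list_prod (l : List (SymAlg s)) (h : ∀ f ∈ l, adj f = f) :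
    adj l.prod = l.reverse.prod := by
  induction l with
  | nil => simp [adj_one]
  | cons f l ih =>
    simp only [List.prod_cons, adj_mul, List.reverse_cons, List.prod_append]
    rw [ih fun g hg => h g (List.mem_cons_of_mem _ hg), h f List.mem_cons_self]
    simp

end Conjugation

/-! ### Sets of operators -/

/-- `A^m B^n`: the products `E^{x₁}_{a₁} ⋯ E^{x_{m'}}_{a_{m'}} F^{y₁}_{b₁} ⋯ F^{y_{n'}}_{b_{n'}}`
with `m' ≤ m` and `n' ≤ n`. -/
def opsAB (s : Scenario) (m n : ℕ) : Set (SymAlg s) :=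
  {w | ∃ (u : List (s.X × s.A)) (v : List (s.Y × s.B)), u.length ≤ m ∧ v.length ≤ n ∧
    w = (u.map fun p => E p.1 p.2).prod * (v.map fun p => F p.1 p.2).prod}

/-- A union `O` of sets `A^m B^n`, over the pairs `(m, n) ∈ index`, that contains all of Alice's
and all of Bob's symbolic projectors. -/
structure OperatorSet where
  index : Set (ℕ × ℕ)
  contains_A : ∃ p ∈ index, 1 ≤ p.1
  contains_B : ∃ p ∈ index, 1 ≤ p.2

/-- The elements of `O` in the scenario `s`. -/
def OperatorSet.ops (O : OperatorSet) (s : Scenario) : Set (SymAlg s) :=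
  ⋃ p ∈ O.index, opsAB s p.1 p.2

/-- `O̅`, the real linear combinations of elements of `O`. -/
noncomputable def OperatorSet.bar (O : OperatorSet) (s : Scenario) : Submodule ℝ (SymAlg s) :=
  Submodule.span ℝ (O.ops s)

/-- `O̅²`, the real linear combinations of products of two elements of `O`. -/
noncomputable def OperatorSet.bar2 (O : OperatorSet) (s : Scenario) : Submodule ℝ (SymAlg s) :=
  Submodule.span ℝ (O.ops s * O.ops s)

section Membership

variable (O : OperatorSet) {s : Scenario}

theorem OperatorSet.one_mem_ops : (1 : SymAlg s) ∈ O.ops s := by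
  obtain ⟨p, hp, -⟩ := O.contains_A
  exact Set.mem_biUnion hp ⟨[], [], by simp, by simp, by simp⟩

theorem OperatorSet.E_mem_ops (x : s.X) (a : s.A) : E x a ∈ O.ops s := by
  obtain ⟨p, hp, h⟩ := O.contains_A
  exact Set.mem_biUnion hp ⟨[(x, a)], [], by simpa using h, by simp, by simp⟩

theorem OperatorSet.F_mem_ops (y : s.Y) (b : s.B) : F y b ∈ O.ops s := by
  obtain ⟨p, hp, h⟩ := O.contains_B
  exact Set.mem_biUnion hp ⟨[], [(y, b)], by simp, by simpa using h, by simp⟩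

theorem OperatorSet.adj_mem_ops {w : SymAlg s} (hw : w ∈ O.ops s) : adj w ∈ O.ops s := by
  simp only [OperatorSet.ops, Set.mem_iUnion] at hw
  obtain ⟨p, hp, u, v, hu, hv, rfl⟩ := hw
  refine Set.mem_biUnion hp ⟨u.reverse, v.reverse, by simpa using hu, by simpa using hv, ?_⟩
  rw [E_list_mul_F_list, adj_mul, adj_list_prod, adj_list_prod, List.map_reverse,
    List.map_reverse]
  · intro f hf
    obtain ⟨q, -, rfl⟩ := List.mem_map.1 hf
    exact adj_F _ _
  · intro f hf
    obtain ⟨q, -, rfl⟩ := List.mem_map.1 hf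
    exact adj_E _ _

theorem OperatorSet.adj_mem_bar {f : SymAlg s} (hf : f ∈ O.bar s) : adj f ∈ O.bar s := by
  have h : O.bar s ≤ (O.bar s).comap adj :=
    Submodule.span_le.2 fun _ hw => Submodule.subset_span (O.adj_mem_ops hw)
  exact h hf

theorem OperatorSet.mul_mem_bar2 {f g : SymAlg s} (hf : f ∈ O.bar s) (hg : g ∈ O.bar s) :
    f * g ∈ O.bar2 s := by
  have h := Submodule.mul_mem_mul hf hg
  rwa [OperatorSet.bar, Submodule.span_mul_span] at h

theorem OperatorSet.one_mem_bar2 : (1 : SymAlg s) ∈ O.bar2 s :=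
  Submodule.subset_span ⟨1, O.one_mem_ops, 1, O.one_mem_ops, mul_one 1⟩

theorem OperatorSet.E_mul_F_mem_bar2 (x : s.X) (a : s.A) (y : s.Y) (b : s.B) :
    E x a * F y b ∈ O.bar2 s :=
  Submodule.subset_span ⟨_, O.E_mem_ops x a, _, O.F_mem_ops y b, rfl⟩

theorem OperatorSet.mul_adj_mem_bar2 {f : SymAlg s} (hf : f ∈ O.bar s) :
    f * adj f ∈ O.bar2 s :=
  O.mul_mem_bar2 hf (O.adj_mem_bar hf)

end Membership

/-- `P(a,b|x,y)` is `O`-positive: it is a no-signalling distribution, and there is a linear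
functional `L : O̅² → ℝ` with `L(1) = 1`, `L(f f†) ≥ 0` for all `f ∈ O̅`, and
`P(a,b|x,y) = L(E^x_a F^y_b)`. -/
def IsOPositive (O : OperatorSet) {s : Scenario} (P : Table s) : Prop :=
  IsNoSignalling P ∧ ∃ L : O.bar2 s →ₗ[ℝ] ℝ,
    L ⟨1, O.one_mem_bar2⟩ = 1 ∧
    (∀ (f : SymAlg s) (hf : f ∈ O.bar s), 0 ≤ L ⟨f * adj f, O.mul_adj_mem_bar2 hf⟩) ∧
    ∀ x y a b, P x y a b = L ⟨E x a * F y b, O.E_mul_F_mem_bar2 x a y b⟩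

/-- A set of correlations: in each Bell scenario, a set of tables. -/
abbrev CorrelationSet : Type 1 := (s : Scenario) → Set (Table s)

/-- `Q^O`, the set of `O`-positive correlations. -/
def QO (O : OperatorSet) : CorrelationSet := fun _ => {P | IsOPositive O P}

/-- The union of the sets `A^m B^(N-m)` for `0 ≤ m ≤ N`. -/
def npaOperators (N : ℕ) (hN : 1 ≤ N) : OperatorSet where
  index := {p | p.1 + p.2 = N}
  contains_A := ⟨(N, 0), by simp, hN⟩
  contains_B := ⟨(0, N), by simp, hN⟩

/-- The `N`-th level `Q^N` of the NPA hierarchy. -/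
def npaLevel (N : ℕ) (hN : 1 ≤ N) : CorrelationSet := QO (npaOperators N hN)

/-! ### Wirings -/

/-- A deterministic adaptive strategy of one party acting on a family of boxes, where box `i` has
inputs `In i` and outputs `Out i`; `S` is the set of boxes not used yet.  The party either stops
and announces a result, or chooses an unused box and an input for it, and continues in a way that
depends on the output obtained (hence, along the tree, on the whole previous history). -/
inductive Strategy {ι : Type} [DecidableEq ι] (In Out : ι → Type) (R : Type) : Finset ι → Type
  | announce {S : Finset ι} (r : R) : Strategy In Out R S
  | measure {S : Finset ι} (i : ι) (hi : i ∈ S) (x : In i)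
      (next : Out i → Strategy In Out R (S.erase i)) : Strategy In Out R S

/-- The sum of `g` over all possible runs of a strategy.  A run is recorded by the result
announced at its end, and by the pair (input, output) of every box that was used in it. -/
def Strategy.sumRuns {ι : Type} [DecidableEq ι] {In Out : ι → Type} [∀ i, Fintype (Out i)]
    {R : Type} {M : Type} [AddCommMonoid M] {S : Finset ι} :
    Strategy In Out R S → ((∀ i, Option (In i × Out i)) → R → M) → M
  | .announce r, g => g (fun _ => none) r
  | .measure i _ x next, g =>
      ∑ a, (next a).sumRuns fun record r => g (Function.update record i (some (x, a))) r

/-- The probability that a pair of boxes gives to the events recorded by the two parties; a party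
that did not use its box is traced out (by no-signalling, its input is irrelevant). -/
noncomputable def Table.prob {s : Scenario} (P : Table s) :
    Option (s.X × s.A) → Option (s.Y × s.B) → ℝ
  | some (x, a), some (y, b) => P x y a b
  | some (x, a), none => ∑ b, P x (Classical.arbitrary s.Y) a b
  | none, some (y, b) => ∑ a, P (Classical.arbitrary s.X) y a b
  | none, none => 1

section Wire

variable {n : ℕ} (s : Fin n → Scenario) (t : Scenario)

/-- A wiring of Alice: for every effective input, a strategy announcing an effective output. -/
abbrev WiringA : Type :=
  t.X → Strategy (fun i => (s i).X) (fun i => (s i).A) t.A Finset.univ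

/-- A wiring of Bob. -/
abbrev WiringB : Type :=
  t.Y → Strategy (fun i => (s i).Y) (fun i => (s i).B) t.B Finset.univ

end Wire

/-- The effective box `(W_A ⊗ W_B)(⊗ᵢ Pᵢ)`: the probability of `(a, b)` given `(x, y)` is the sum,
over the pairs of runs of the strategies of Alice for `x` and of Bob for `y` that announce `a`
and `b`, of the product over the boxes of the probabilities of the recorded events. -/
noncomputable def wire {n : ℕ} {s : Fin n → Scenario} {t : Scenario}
    (P : (i : Fin n) → Table (s i)) (WA : WiringA s t) (WB : WiringB s t) : Table t :=
  fun x y a b =>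
    (WA x).sumRuns fun α a' => (WB y).sumRuns fun β b' =>
      if a' = a ∧ b' = b then ∏ i, (P i).prob (α i) (β i) else 0

/-- Any wiring of finitely many boxes of `𝒮` (possibly from different scenarios) is in `𝒮`. -/
def ClosedUnderWirings (𝒮 : CorrelationSet) : Prop :=
  ∀ (n : ℕ) (s : Fin n → Scenario) (P : (i : Fin n) → Table (s i)),
    (∀ i, P i ∈ 𝒮 (s i)) →
      ∀ (t : Scenario) (WA : WiringA s t) (WB : WiringB s t), wire P WA WB ∈ 𝒮 t

end Wirings

/-!
A wiring is turned into a homomorphism of symbolic algebras, and the functional of the wired box is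
the tensor product of the functionals of the boxes, pulled back along it.

A strategy and a result `r` define an *effective projector* in the tensor product of the symbolic
algebras of the boxes: the sum, over the runs announcing `r`, of the tensor product of the recorded
projectors. Two different runs first differ in the output of a box that was given the same input,
so the effective projectors of a strategy are idempotent and orthogonal
(`effective_mul_effective`); those of Alice commute with those of Bob. Hence the effective
projectors satisfy the defining relations and yield a homomorphism `wiringHom`, which intertwines
the conjugations (`wiringHom_adj`). As every box is used at most once in a run, `wiringHom` maps
`A^m B^n` into the span of the tensors with all factors in `A^m B^n`
(`wiringHom_mem_tensorSpan`). This is why it matters that the operator set is a union of sets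
`A^m B^n`: such a union is sent into the span of the tensors with all factors in the corresponding
set for the boxes.

Positivity of the tensor product of the functionals on that span is Schur's product theorem for
Gram matrices (`tensorState_nonneg`). It requires symmetric forms, which is achieved by averaging a
functional with its conjugate. The value of the tensor product functional on a pair of effective
projectors is a sum over pairs of runs of products of the values on the recorded events
(`tensorState_wiringHom`). For this to be the wired box, each functional must also reproduce the
marginals of its box, although the relation `∑ a, E x a = 1` is not imposed on the symbols. It does
so because `1 - ∑ a, E x a` is a null vector of the functional, by the Cauchy–Schwarz inequality
(`IsOPositive.exists_state`).
-/

namespace Wirings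

open scoped TensorProduct

/-! ### Sums over runs -/

namespace Strategy

variable {ι : Type} [DecidableEq ι] {In Out : ι → Type} [∀ i, Fintype (Out i)] {R : Type}

/-- A run of a strategy on `S` leaves no record on the boxes outside `S`. -/
theorem sumRuns_congr {M : Type} [AddCommMonoid M] {S : Finset ι} (σ : Strategy In Out R S)
    {g g' : (∀ i, Option (In i × Out i)) → R → M}
    (h : ∀ α r, (∀ j ∉ S, α j = none) → g α r = g' α r) : σ.sumRuns g = σ.sumRuns g' := by
  induction σ generalizing g g' with
  | announce r => exact h _ _ fun _ _ => rfl
  | measure i hi x next ih =>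
    simp only [sumRuns]
    refine Finset.sum_congr rfl fun a _ => ih a fun α r hα => h _ _ fun j hj => ?_
    have hji : j ≠ i := fun e => hj (e ▸ hi)
    rw [Function.update_of_ne hji]
    exact hα j fun hj' => hj (Finset.mem_of_mem_erase hj')

theorem map_sumRuns {M M' H : Type} [AddCommMonoid M] [AddCommMonoid M'] [FunLike H M M']
    [AddMonoidHomClass H M M'] {S : Finset ι} (σ : Strategy In Out R S) (f : H)
    (g : (∀ i, Option (In i × Out i)) → R → M) :
    f (σ.sumRuns g) = σ.sumRuns fun α r => f (g α r) := by
  induction σ generalizing g with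
  | announce r => rfl
  | measure i hi x next ih => simp only [sumRuns, map_sum, ih]

theorem sum_sumRuns {M κ : Type} [AddCommMonoid M] {S : Finset ι} (σ : Strategy In Out R S)
    (s : Finset κ) (g : κ → (∀ i, Option (In i × Out i)) → R → M) :
    ∑ k ∈ s, σ.sumRuns (g k) = σ.sumRuns fun α r => ∑ k ∈ s, g k α r := by
  induction σ generalizing g with
  | announce r => rfl
  | measure i hi x next ih =>
    simp only [sumRuns]
    rw [Finset.sum_comm]
    exact Finset.sum_congr rfl fun a _ => ih a _

theorem sumRuns_comm {ι' : Type} [DecidableEq ι'] {In' Out' : ι' → Type} [∀ i, Fintype (Out' i)]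
    {R' M : Type} [AddCommMonoid M] {S : Finset ι} {S' : Finset ι'} (σ : Strategy In Out R S)
    (τ : Strategy In' Out' R' S')
    (g : (∀ i, Option (In i × Out i)) → R → (∀ i, Option (In' i × Out' i)) → R' → M) :
    (σ.sumRuns fun α r => τ.sumRuns (g α r)) =
      τ.sumRuns fun β r' => σ.sumRuns fun α r => g α r β r' := by
  induction σ generalizing g with
  | announce r => rfl
  | measure i hi x next ih =>
    simp only [sumRuns]
    rw [← sum_sumRuns]
    exact Finset.sum_congr rfl fun a _ => ih a _

theorem sumRuns_mem {M K : Type} [AddCommMonoid M] [SetLike K M] [AddSubmonoidClass K M] (N : K)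
    {S : Finset ι} (σ : Strategy In Out R S) {g : (∀ i, Option (In i × Out i)) → R → M}
    (h : ∀ α r, g α r ∈ N) : σ.sumRuns g ∈ N := by
  induction σ generalizing g with
  | announce r => exact h _ _
  | measure i hi x next ih => exact sum_mem fun a _ => ih a fun _ _ => h _ _

theorem sumRuns_nonneg {S : Finset ι} (σ : Strategy In Out R S)
    {g : (∀ i, Option (In i × Out i)) → R → ℝ} (h : ∀ α r, 0 ≤ g α r) : 0 ≤ σ.sumRuns g := by
  induction σ generalizing g with
  | announce r => exact h _ _
  | measure i hi x next ih => exact Finset.sum_nonneg fun a _ => ih a fun _ _ => h _ _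

/-- If the weights of the outputs of every box sum to the weight of leaving that box unused, then
the total weight of the runs of a strategy is that of using no box at all. -/
theorem sumRuns_prod [Fintype ι] {S : Finset ι} (σ : Strategy In Out R S)
    (w : ∀ i, Option (In i × Out i) → ℝ)
    (hw : ∀ i ∈ S, ∀ x, ∑ a, w i (some (x, a)) = w i none) :
    σ.sumRuns (fun β _ => ∏ i, w i (β i)) = ∏ i, w i none := by
  induction σ generalizing w with
  | announce r => rfl
  | @measure S i hi x next ih =>
    simp only [sumRuns]
    -- Once box `i` has given the output `a`, its weight is frozen at `w i (some (x, a))`.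
    have key : ∀ a, (next a).sumRuns (fun β _ =>
        ∏ j, w j (Function.update β i (some (x, a)) j)) =
          w i (some (x, a)) * ∏ j ∈ Finset.univ.erase i, w j none := by
      intro a
      have h := ih a (Function.update w i fun _ => w i (some (x, a))) (by
        intro j hj y
        have hji := Finset.ne_of_mem_erase hj
        simpa [Function.update_of_ne hji] using hw j (Finset.mem_of_mem_erase hj) y)
      rw [← Finset.mul_prod_erase _ _ (Finset.mem_univ i)] at h
      rw [Function.update_self] at h
      rw [Finset.prod_congr rfl fun j hj => by
        rw [Function.update_of_ne (Finset.ne_of_mem_erase hj)]] at h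
      rw [← h]
      refine sumRuns_congr _ fun β r _ => Finset.prod_congr rfl fun j _ => ?_
      by_cases hji : j = i
      · subst hji; simp
      · simp [hji]
    rw [Finset.sum_congr rfl fun a _ => key a, ← Finset.sum_mul, hw i hi x,
      Finset.mul_prod_erase _ (fun j => w j none) (Finset.mem_univ i)]

end Strategy

/-! ### Effective projectors -/

/-- The element attached to the record of one box: `1` if the box was not used, and `p x a` if it
was given the input `x` and answered `a`. -/
def recorded {X A M : Type} [One M] (p : X → A → M) : Option (X × A) → M
  | none => 1
  | some (x, a) => p x a

section Effective

variable {ι : Type} [DecidableEq ι] {In Out : ι → Type} [∀ i, Fintype (Out i)]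
  {R : Type} [DecidableEq R] {Alg : ι → Type} [∀ i, Ring (Alg i)] [∀ i, Algebra ℝ (Alg i)]

/-- The effective projector of the result `r` of a strategy: the sum, over the runs announcing `r`,
of the tensor product of the projectors `p i x a` recorded in the run. -/
noncomputable def effective (p : ∀ i, In i → Out i → Alg i) {S : Finset ι}
    (σ : Strategy In Out R S) (r : R) : ⨂[ℝ] i, Alg i :=
  σ.sumRuns fun α r' =>
    if r' = r then PiTensorProduct.tprod ℝ fun i => recorded (p i) (α i) else 0

variable (p : ∀ i, In i → Out i → Alg i)

theorem effective_announce {S : Finset ι} (r' r : R) :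
    effective p (Strategy.announce (S := S) r') r = if r' = r then 1 else 0 := rfl

theorem effective_measure {S : Finset ι} (i : ι) (hi : i ∈ S) (x : In i)
    (next : Out i → Strategy In Out R (S.erase i)) (r : R) :
    effective p (.measure i hi x next) r =
      ∑ a, PiTensorProduct.singleAlgHom (R := ℝ) i (p i x a) * effective p (next a) r := by
  simp only [effective, Strategy.sumRuns]
  refine Finset.sum_congr rfl fun a _ => ?_
  refine Eq.trans ?_ (Strategy.map_sumRuns (next a) (AddMonoidHom.mulLeft
    (PiTensorProduct.singleAlgHom (R := ℝ) i (p i x a))) _).symm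
  refine Strategy.sumRuns_congr _ fun α r' hα => ?_
  rw [AddMonoidHom.coe_mulLeft, mul_ite, mul_zero]
  congr 1
  rw [PiTensorProduct.singleAlgHom_apply, PiTensorProduct.tprod_mul_tprod]
  congr 1
  funext j
  by_cases hj : j = i
  · subst hj
    simp [recorded, hα j (Finset.notMem_erase j S)]
  · simp [Pi.mulSingle_eq_of_ne hj, Function.update_of_ne hj]

theorem commute_effective {S : Finset ι} (σ : Strategy In Out R S) (r : R) {z : ⨂[ℝ] i, Alg i}
    (hz : ∀ i ∈ S, ∀ x a, Commute z (PiTensorProduct.singleAlgHom (R := ℝ) i (p i x a))) :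
    Commute z (effective p σ r) := by
  induction σ with
  | announce r' =>
    rw [effective_announce]
    split_ifs
    · exact Commute.one_right _
    · exact Commute.zero_right _
  | measure i hi x next ih =>
    rw [effective_measure]
    exact Commute.sum_right _ _ _ fun a _ => (hz i hi x a).mul_right
      (ih a fun j hj => hz j (Finset.mem_of_mem_erase hj))

theorem commute_singleAlgHom {i j : ι} (h : i ≠ j) (u : Alg i) (v : Alg j) :
    Commute (PiTensorProduct.singleAlgHom (R := ℝ) (A := Alg) i u)
      (PiTensorProduct.singleAlgHom (R := ℝ) j v) := by
  rw [PiTensorProduct.singleAlgHom_apply, PiTensorProduct.singleAlgHom_apply]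
  exact Commute.tprod (Pi.mulSingle_commute h u v)

theorem commute_singleAlgHom_self {i : ι} {u v : Alg i} (h : Commute u v) :
    Commute (PiTensorProduct.singleAlgHom (R := ℝ) (A := Alg) i u)
      (PiTensorProduct.singleAlgHom (R := ℝ) i v) :=
  h.map _

/-- The effective projectors of a strategy are idempotent and pairwise orthogonal: two different
runs first differ in the output of a box to which both gave the same input. -/
theorem effective_mul_effective [∀ i, DecidableEq (Out i)]
    (hp : ∀ i x a a', p i x a * p i x a' = if a = a' then p i x a else 0)
    {S : Finset ι} (σ : Strategy In Out R S) (r r' : R) :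
    effective p σ r * effective p σ r' = if r = r' then effective p σ r else 0 := by
  induction σ with
  | announce r₀ =>
    simp only [effective_announce]
    by_cases h : r₀ = r
    · subst h; simp
    · simp [h]
  | measure i hi x next ih =>
    have hc : ∀ a a', Commute (PiTensorProduct.singleAlgHom (R := ℝ) i (p i x a'))
        (effective p (next a) r) := fun a a' => commute_effective p _ _ fun j hj y b =>
      commute_singleAlgHom (Finset.ne_of_mem_erase hj).symm _ _
    have key : ∀ a a', PiTensorProduct.singleAlgHom (R := ℝ) i (p i x a) * effective p (next a) r *
        (PiTensorProduct.singleAlgHom (R := ℝ) i (p i x a') * effective p (next a') r') =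
          if a = a' then PiTensorProduct.singleAlgHom (R := ℝ) i (p i x a) *
            (if r = r' then effective p (next a) r else 0) else 0 := by
      intro a a'
      rw [mul_assoc, ← mul_assoc (effective p (next a) r), ← (hc a a').eq, mul_assoc, ← mul_assoc,
        ← map_mul, hp]
      split_ifs with h h'
      · subst h; rw [ih, if_pos h']
      · subst h; rw [ih, if_neg h']
      · rw [map_zero, zero_mul]
    simp only [effective_measure, Finset.sum_mul_sum, key, Finset.sum_ite_eq, Finset.mem_univ,
      if_true]
    split_ifs <;> simp

theorem commute_effective_effective {In' Out' : ι → Type} [∀ i, Fintype (Out' i)]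
    {R' : Type} [DecidableEq R'] (q : ∀ i, In' i → Out' i → Alg i)
    (h : ∀ i x a y b, Commute (p i x a) (q i y b)) {S S' : Finset ι}
    (σ : Strategy In Out R S) (τ : Strategy In' Out' R' S') (r : R) (r' : R') :
    Commute (effective p σ r) (effective q τ r') := by
  refine commute_effective q _ _ fun j _ y b => (commute_effective p _ _ fun i _ x a => ?_).symm
  by_cases hij : i = j
  · subst hij
    exact commute_singleAlgHom_self (h i x a y b).symm
  · exact commute_singleAlgHom (Ne.symm hij) _ _

end Effective

/-! ### Spans of elementary tensors -/

section TensorSpan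

variable {ι : Type} {Alg : ι → Type} [∀ i, Ring (Alg i)] [∀ i, Algebra ℝ (Alg i)]

/-- The linear combinations of the elementary tensors whose `i`-th factor lies in `T i`. -/
def tensorSpan (T : ∀ i, Set (Alg i)) : Submodule ℝ (⨂[ℝ] i, Alg i) :=
  Submodule.span ℝ (PiTensorProduct.tprod ℝ '' Set.univ.pi T)

theorem tprod_mem_tensorSpan {T : ∀ i, Set (Alg i)} {w : ∀ i, Alg i} (h : ∀ i, w i ∈ T i) :
    PiTensorProduct.tprod ℝ w ∈ tensorSpan T :=
  Submodule.subset_span ⟨w, fun i _ => h i, rfl⟩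

theorem tensorSpan_mono {T T' : ∀ i, Set (Alg i)} (h : ∀ i, T i ⊆ T' i) :
    tensorSpan T ≤ tensorSpan T' :=
  Submodule.span_mono (Set.image_mono (Set.pi_mono fun i _ => h i))

theorem mul_mem_tensorSpan {T T' T'' : ∀ i, Set (Alg i)}
    (h : ∀ i, ∀ u ∈ T i, ∀ v ∈ T' i, u * v ∈ T'' i) {f g : ⨂[ℝ] i, Alg i}
    (hf : f ∈ tensorSpan T) (hg : g ∈ tensorSpan T') : f * g ∈ tensorSpan T'' := by
  have hfg := Submodule.mul_mem_mul hf hg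
  rw [tensorSpan, tensorSpan, Submodule.span_mul_span] at hfg
  refine Submodule.span_le.2 ?_ hfg
  rintro _ ⟨_, ⟨u, hu, rfl⟩, _, ⟨v, hv, rfl⟩, rfl⟩
  simp only [PiTensorProduct.tprod_mul_tprod]
  exact tprod_mem_tensorSpan fun i => h i _ (hu i trivial) _ (hv i trivial)

theorem effective_mem_tensorSpan [DecidableEq ι] {In Out : ι → Type} [∀ i, Fintype (Out i)]
    {R : Type} [DecidableEq R] (p : ∀ i, In i → Out i → Alg i) {T : ∀ i, Set (Alg i)}
    (h1 : ∀ i, 1 ∈ T i) (hp : ∀ i x a, p i x a ∈ T i) {S : Finset ι}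
    (σ : Strategy In Out R S) (r : R) : effective p σ r ∈ tensorSpan T := by
  refine Strategy.sumRuns_mem _ σ fun α r' => ?_
  split_ifs
  · refine tprod_mem_tensorSpan fun i => ?_
    rcases α i with _ | ⟨x, a⟩
    · exact h1 i
    · exact hp i x a
  · exact zero_mem _

end TensorSpan

/-! ### The symbolic algebra and its conjugation -/

section SymAlg

variable {s : Scenario}

/-- A subalgebra containing all symbolic projectors is everything. -/
theorem mem_of_symbols_mem (N : Subalgebra ℝ (SymAlg s)) (hE : ∀ x a, E x a ∈ N)
    (hF : ∀ y b, F y b ∈ N) (f : SymAlg s) : f ∈ N := by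
  obtain ⟨g, rfl⟩ := RingQuot.mkAlgHom_surjective ℝ (EventRel s) f
  induction g using FreeAlgebra.induction with
  | grade0 r => rw [AlgHom.commutes]; exact N.algebraMap_mem r
  | grade1 e =>
    cases e with
    | alice x a => exact hE x a
    | bob y b => exact hF y b
  | mul f g hf hg => rw [map_mul]; exact N.mul_mem hf hg
  | add f g hf hg => rw [map_add]; exact N.add_mem hf hg

theorem adj_algebraMap (r : ℝ) : adj (algebraMap ℝ (SymAlg s) r) = algebraMap ℝ _ r := by
  rw [Algebra.algebraMap_eq_smul_one, map_smul, adj_one]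

theorem adj_adj (f : SymAlg s) : adj (adj f) = f := by
  let N : Subalgebra ℝ (SymAlg s) :=
    { carrier := {f | adj (adj f) = f}
      mul_mem' := fun {f g} hf hg => by
        simp only [Set.mem_ofPred_eq] at hf hg ⊢
        rw [adj_mul, adj_mul, hf, hg]
      add_mem' := fun {f g} hf hg => by
        simp only [Set.mem_ofPred_eq] at hf hg ⊢
        rw [map_add, map_add, hf, hg]
      algebraMap_mem' := fun r => by
        simp only [Set.mem_ofPred_eq]
        rw [adj_algebraMap, adj_algebraMap] }
  exact mem_of_symbols_mem N (fun x a => by change adj (adj _) = _; rw [adj_E, adj_E])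
    (fun y b => by change adj (adj _) = _; rw [adj_F, adj_F]) f

theorem E_mul_E (x : s.X) (a a' : s.A) : E x a * E x a' = if a = a' then E x a else 0 := by
  split_ifs with h
  · rw [← h, E_mul_self]
  · exact E_mul_of_ne x h

theorem F_mul_F (y : s.Y) (b b' : s.B) : F y b * F y b' = if b = b' then F y b else 0 := by
  split_ifs with h
  · rw [← h, F_mul_self]
  · exact F_mul_of_ne y h

theorem opsAB_mono {m n m' n' : ℕ} (hm : m ≤ m') (hn : n ≤ n') :
    opsAB s m n ⊆ opsAB s m' n' := by
  rintro _ ⟨u, v, hu, hv, rfl⟩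
  exact ⟨u, v, hu.trans hm, hv.trans hn, rfl⟩

theorem one_mem_opsAB (m n : ℕ) : (1 : SymAlg s) ∈ opsAB s m n :=
  ⟨[], [], by simp, by simp, by simp⟩

theorem E_mem_opsAB (x : s.X) (a : s.A) : E x a ∈ opsAB s 1 0 :=
  ⟨[(x, a)], [], by simp, by simp, by simp⟩

theorem F_mem_opsAB (y : s.Y) (b : s.B) : F y b ∈ opsAB s 0 1 :=
  ⟨[], [(y, b)], by simp, by simp, by simp⟩

theorem mul_mem_opsAB {m n m' n' : ℕ} {f g : SymAlg s} (hf : f ∈ opsAB s m n)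
    (hg : g ∈ opsAB s m' n') : f * g ∈ opsAB s (m + m') (n + n') := by
  obtain ⟨u, v, hu, hv, rfl⟩ := hf
  obtain ⟨u', v', hu', hv', rfl⟩ := hg
  refine ⟨u ++ u', v ++ v', by simp; omega, by simp; omega, ?_⟩
  simp only [List.map_append, List.prod_append]
  rw [mul_assoc, ← mul_assoc (List.prod (v.map _)), ← E_list_mul_F_list]
  simp only [mul_assoc]

end SymAlg

/-! ### Symmetric extensions of positive functionals -/

section State

variable {s : Scenario}

/-- `Λ` is a linear functional on the whole symbolic algebra that is normalized, invariant under
conjugation, and nonnegative on the elements `f f†` with `f ∈ O̅`. -/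
structure IsOState (O : OperatorSet) (Λ : SymAlg s →ₗ[ℝ] ℝ) : Prop where
  map_one : Λ 1 = 1
  map_adj : ∀ f, Λ (adj f) = Λ f
  nonneg : ∀ f ∈ O.bar s, 0 ≤ Λ (f * adj f)

namespace IsOState

variable {O : OperatorSet} {Λ : SymAlg s →ₗ[ℝ] ℝ}

theorem map_mul_adj_comm (h : IsOState O Λ) (f g : SymAlg s) :
    Λ (f * adj g) = Λ (g * adj f) := by
  rw [← h.map_adj, adj_mul, adj_adj]

/-- The equality case of the Cauchy–Schwarz inequality. -/
theorem map_mul_adj_eq_zero (h : IsOState O Λ) {f g : SymAlg s} (hf : f ∈ O.bar s)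
    (hg : g ∈ O.bar s) (h0 : Λ (f * adj f) = 0) : Λ (f * adj g) = 0 := by
  by_contra hc
  have hq : ∀ c : ℝ, 0 ≤ 2 * c * Λ (f * adj g) + Λ (g * adj g) := by
    intro c
    have := h.nonneg (c • f + g) (add_mem (Submodule.smul_mem _ c hf) hg)
    simp only [map_add, map_smul, add_mul, mul_add, smul_mul_assoc, mul_smul_comm, h0,
      smul_eq_mul, h.map_mul_adj_comm g f] at this
    linarith
  -- The quadratic form has no leading term, so this value of `c` makes it equal to `-1`.
  have := hq (-(Λ (g * adj g) + 1) / (2 * Λ (f * adj g)))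
  field_simp at this
  linarith

/-- If two self-adjoint projectors satisfy `Λ (e f) = 1`, then `1 - e` is a null vector: positivity
on `1 - e`, `1 - f` and `e - f` gives `Λ e ≤ 1`, `Λ f ≤ 1` and `Λ e + Λ f ≥ 2`. -/
theorem map_mul_eq_map (h : IsOState O Λ) {e f : SymAlg s} (he : e ∈ O.bar s) (hf : f ∈ O.bar s)
    (hee : e * e = e) (hff : f * f = f) (hae : adj e = e) (haf : adj f = f)
    (hef : Λ (e * f) = 1) {g : SymAlg s} (hg : g ∈ O.bar s) : Λ (e * adj g) = Λ (adj g) := by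
  have h1 : (1 : SymAlg s) ∈ O.bar s := Submodule.subset_span O.one_mem_ops
  have hfe : Λ (f * e) = 1 := by
    have := h.map_mul_adj_comm f e
    rwa [hae, haf, hef] at this
  have p1 := h.nonneg (1 - e) (sub_mem h1 he)
  have p2 := h.nonneg (1 - f) (sub_mem h1 hf)
  have p3 := h.nonneg (e - f) (sub_mem he hf)
  simp only [map_sub, adj_one, hae, haf, sub_mul, mul_sub, hee, hff, one_mul, mul_one, hef, hfe,
    h.map_one] at p1 p2 p3
  have hz : Λ ((1 - e) * adj (1 - e)) = 0 := by
    simp only [map_sub, adj_one, hae, sub_mul, mul_sub, hee, one_mul, mul_one, h.map_one]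
    linarith
  have := h.map_mul_adj_eq_zero (sub_mem h1 he) hg hz
  rw [sub_mul, one_mul, map_sub] at this
  linarith

end IsOState

theorem sum_E_mul_sum_E (x : s.X) : (∑ a, E x a) * ∑ a, E x a = ∑ a : s.A, E x a := by
  simp [Finset.sum_mul_sum, E_mul_E]

theorem sum_F_mul_sum_F (y : s.Y) : (∑ b, F y b) * ∑ b, F y b = ∑ b : s.B, F y b := by
  simp [Finset.sum_mul_sum, F_mul_F]

theorem adj_sum_E (x : s.X) : adj (∑ a, E x a) = ∑ a : s.A, E x a := by
  simp [adj_E]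

theorem adj_sum_F (y : s.Y) : adj (∑ b, F y b) = ∑ b : s.B, F y b := by
  simp [adj_F]

/-- Every functional witnessing `O`-positivity can be replaced by a state that also gives the
marginals. No relation `∑ a, E x a = 1` is imposed on the symbols, so the marginals need an
argument: `1 - ∑ a, E x a` is a null vector of the state. -/
theorem IsOPositive.exists_state {O : OperatorSet} {P : Table s} (h : IsOPositive O P) :
    ∃ Λ : SymAlg s →ₗ[ℝ] ℝ, IsOState O Λ ∧
      ∀ o o', Λ (recorded E o * recorded F o') = P.prob o o' := by
  obtain ⟨hP, L, hL1, hLpos, hLP⟩ := h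
  obtain ⟨L', hL'⟩ := LinearMap.exists_extend L
  have ext : ∀ f (hf : f ∈ O.bar2 s), L' f = L ⟨f, hf⟩ := fun f hf => by
    rw [← hL']; rfl
  -- The form `(f, g) ↦ L (f g†)` need not be symmetric, and positivity of tensor products fails
  -- for real forms that are not. Symmetrizing keeps all the values that matter, since these are
  -- taken at self-conjugate elements.
  let Λ : SymAlg s →ₗ[ℝ] ℝ := (2⁻¹ : ℝ) • (L' + L' ∘ₗ adj)
  have hΛ : ∀ f, Λ f = 2⁻¹ * (L' f + L' (adj f)) := fun f => rfl
  have hself : ∀ f, adj f = f → Λ f = L' f := fun f hf => by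
    rw [hΛ, hf]; ring
  have hst : IsOState O Λ :=
    { map_one := by rw [hself _ adj_one, ext _ O.one_mem_bar2, hL1]
      map_adj := fun f => by rw [hΛ, hΛ, adj_adj, add_comm]
      nonneg := fun f hf => by
        rw [hself _ (by rw [adj_mul, adj_adj]), ext _ (O.mul_adj_mem_bar2 hf)]
        exact hLpos f hf }
  have hEF : ∀ x a y b, Λ (E x a * F y b) = P x y a b := fun x a y b => by
    rw [hself _ (by rw [adj_mul, adj_E, adj_F, E_mul_F]), ext _ (O.E_mul_F_mem_bar2 x a y b), hLP]
  have hE : ∀ x a, E x a ∈ O.bar s := fun x a => Submodule.subset_span (O.E_mem_ops x a)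
  have hF : ∀ y b, F y b ∈ O.bar s := fun y b => Submodule.subset_span (O.F_mem_ops y b)
  have hSE : ∀ x : s.X, ∑ a, E x a ∈ O.bar s := fun x => sum_mem fun a _ => hE x a
  have hSF : ∀ y : s.Y, ∑ b, F y b ∈ O.bar s := fun y => sum_mem fun b _ => hF y b
  have hSS : ∀ (x : s.X) (y : s.Y), Λ ((∑ a, E x a) * ∑ b, F y b) = 1 := fun x y => by
    simp only [Finset.sum_mul_sum, map_sum, hEF, hP.sum_eq_one]
  have hSS' : ∀ (x : s.X) (y : s.Y), Λ ((∑ b, F y b) * ∑ a, E x a) = 1 := fun x y => by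
    rw [← hSS x y, ← hst.map_adj, adj_mul, adj_sum_E, adj_sum_F]
  refine ⟨Λ, hst, ?_⟩
  rintro (_ | ⟨x, a⟩) (_ | ⟨y, b⟩)
  · simpa [recorded, Table.prob] using hst.map_one
  · have := hst.map_mul_eq_map (hSE (Classical.arbitrary s.X)) (hSF y) (sum_E_mul_sum_E _)
      (sum_F_mul_sum_F y) (adj_sum_E _) (adj_sum_F y) (hSS _ y) (hF y b)
    rw [adj_F, Finset.sum_mul, map_sum] at this
    simp only [hEF] at this
    simpa [recorded, Table.prob] using this.symm
  · have := hst.map_mul_eq_map (hSF (Classical.arbitrary s.Y)) (hSE x) (sum_F_mul_sum_F _)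
      (sum_E_mul_sum_E x) (adj_sum_F _) (adj_sum_E x) (hSS' x _) (hE x a)
    rw [adj_E, Finset.sum_mul, map_sum] at this
    simp only [← E_mul_F, hEF] at this
    simpa [recorded, Table.prob] using this.symm
  · exact hEF x a y b

end State

/-! ### Tensor products of positive functionals -/

open Matrix in
/-- Schur's product theorem for finitely many factors. -/
theorem posSemidef_prod {ι κ : Type} [Fintype κ] (S : Finset ι) (M : ι → Matrix κ κ ℝ)
    (h : ∀ i ∈ S, (M i).PosSemidef) :
    (Matrix.of fun k l => ∏ i ∈ S, M i k l).PosSemidef := by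
  classical
  induction S using Finset.induction_on with
  | empty =>
    have := posSemidef_vecMulVec_self_star (1 : κ → ℝ)
    convert this using 1
    ext k l
    simp [vecMulVec_apply]
  | insert i S hi ih =>
    have := (h i (Finset.mem_insert_self i S)).hadamard
      (ih fun j hj => h j (Finset.mem_insert_of_mem hj))
    have e : (Matrix.of fun k l => ∏ j ∈ insert i S, M j k l) =
        M i ⊙ Matrix.of fun k l => ∏ j ∈ S, M j k l := by
      ext k l
      simp [Finset.prod_insert hi]
    rw [e]
    exact this

section Tensor

variable {ι : Type} {s : ι → Scenario}

/-- Conjugation on the tensor product, factor by factor. -/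
noncomputable def tensorAdj : (⨂[ℝ] i, SymAlg (s i)) →ₗ[ℝ] ⨂[ℝ] i, SymAlg (s i) :=
  PiTensorProduct.map fun _ => adj

theorem tensorAdj_tprod (w : ∀ i, SymAlg (s i)) :
    tensorAdj (PiTensorProduct.tprod ℝ w) = PiTensorProduct.tprod ℝ fun i => adj (w i) :=
  PiTensorProduct.map_tprod _ _

theorem tensorAdj_mul (f g : ⨂[ℝ] i, SymAlg (s i)) :
    tensorAdj (f * g) = tensorAdj g * tensorAdj f := by
  induction f using PiTensorProduct.induction_on with
  | add f f' hf hf' => rw [add_mul, map_add, hf, hf', map_add, mul_add]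
  | smul_tprod c u =>
    induction g using PiTensorProduct.induction_on with
    | add g g' hg hg' => rw [mul_add, map_add, hg, hg', map_add, add_mul]
    | smul_tprod d v =>
      rw [PiTensorProduct.smul_tprod_mul_smul_tprod, map_smul, map_smul, map_smul, tensorAdj_tprod,
        tensorAdj_tprod, tensorAdj_tprod, PiTensorProduct.smul_tprod_mul_smul_tprod, mul_comm c d]
      simp only [Pi.mul_apply, adj_mul]
      rfl

variable [Fintype ι]

/-- The tensor product of linear functionals on the symbolic algebras. -/
noncomputable def tensorState (Λ : ∀ i, SymAlg (s i) →ₗ[ℝ] ℝ) : (⨂[ℝ] i, SymAlg (s i)) →ₗ[ℝ] ℝ :=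
  PiTensorProduct.lift ((MultilinearMap.mkPiAlgebra ℝ ι ℝ).compLinearMap Λ)

theorem tensorState_tprod (Λ : ∀ i, SymAlg (s i) →ₗ[ℝ] ℝ) (w : ∀ i, SymAlg (s i)) :
    tensorState Λ (PiTensorProduct.tprod ℝ w) = ∏ i, Λ i (w i) := by
  simp [tensorState]

/-- Positivity passes to tensor products: the Gram matrix of a family of elementary tensors is the
entrywise product of the Gram matrices of their factors. -/
theorem tensorState_nonneg {O : OperatorSet} {Λ : ∀ i, SymAlg (s i) →ₗ[ℝ] ℝ}
    (hΛ : ∀ i, IsOState O (Λ i)) {f : ⨂[ℝ] i, SymAlg (s i)}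
    (hf : f ∈ tensorSpan fun i => O.ops (s i)) : 0 ≤ tensorState Λ (f * tensorAdj f) := by
  obtain ⟨n, c, g, rfl⟩ := Submodule.mem_span_set'.1 hf
  have hg : ∀ k, ∃ w : ∀ i, SymAlg (s i), (∀ i, w i ∈ O.ops (s i)) ∧
      PiTensorProduct.tprod ℝ w = (g k : ⨂[ℝ] i, SymAlg (s i)) := fun k => by
    obtain ⟨w, hw, h⟩ := (g k).2
    exact ⟨w, fun i => hw i trivial, h⟩
  choose w hw hwg using hg
  have hM : ∀ i ∈ Finset.univ,
      (Matrix.of fun k l => Λ i (w k i * adj (w l i))).PosSemidef := by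
    intro i _
    refine Matrix.PosSemidef.of_dotProduct_mulVec_nonneg ?_ fun v => ?_
    · ext k l
      simp [(hΛ i).map_mul_adj_comm (w l i) (w k i)]
    · have := (hΛ i).nonneg (∑ k, v k • w k i)
        (sum_mem fun k _ => Submodule.smul_mem _ _ (Submodule.subset_span (hw k i)))
      simp only [map_sum, map_smul, Finset.sum_mul_sum, smul_mul_assoc, mul_smul_comm,
        smul_eq_mul] at this
      simpa [dotProduct, Matrix.mulVec, Finset.mul_sum, mul_comm, mul_left_comm] using this
  have := (posSemidef_prod Finset.univ _ hM).dotProduct_mulVec_nonneg c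
  simp only [← hwg, map_sum, map_smul, Finset.sum_mul_sum, tensorAdj_tprod,
    PiTensorProduct.smul_tprod_mul_smul_tprod, tensorState_tprod, smul_eq_mul]
  simpa [dotProduct, Matrix.mulVec, Finset.mul_sum, mul_comm, mul_assoc, mul_left_comm] using this

end Tensor

/-! ### Wirings as homomorphisms -/

section Wiring

variable {n : ℕ} {s : Fin n → Scenario} {t : Scenario}

/-- The effective projectors of a wiring, in the tensor product of the symbolic algebras of the
boxes. -/
noncomputable def wiringEvent (WA : WiringA s t) (WB : WiringB s t) :
    Event t → ⨂[ℝ] i, SymAlg (s i)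
  | .alice x a => effective (fun _ => E) (WA x) a
  | .bob y b => effective (fun _ => F) (WB y) b

theorem wiringEvent_rel (WA : WiringA s t) (WB : WiringB s t) ⦃u v : FreeAlgebra ℝ (Event t)⦄
    (h : EventRel t u v) : FreeAlgebra.lift ℝ (wiringEvent WA WB) u =
      FreeAlgebra.lift ℝ (wiringEvent WA WB) v := by
  have hE := fun x => effective_mul_effective (fun i => E (s := s i)) (fun _ => E_mul_E) (WA x)
  have hF := fun y => effective_mul_effective (fun i => F (s := s i)) (fun _ => F_mul_F) (WB y)
  cases h with
  | alice_idem x a => simp [wiringEvent, hE]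
  | bob_idem y b => simp [wiringEvent, hF]
  | alice_orth x a a' h => simp [wiringEvent, hE, h]
  | bob_orth y b b' h => simp [wiringEvent, hF, h]
  | comm x a y b =>
    simp only [map_mul, FreeAlgebra.lift_ι_apply, wiringEvent]
    exact commute_effective_effective _ _ (fun _ x a y b => E_mul_F x a y b) _ _ _ _

/-- The homomorphism sending the symbolic projectors of the effective scenario to the effective
projectors of the wiring. -/
noncomputable def wiringHom (WA : WiringA s t) (WB : WiringB s t) :
    SymAlg t →ₐ[ℝ] ⨂[ℝ] i, SymAlg (s i) :=
  RingQuot.liftAlgHom ℝ ⟨FreeAlgebra.lift ℝ (wiringEvent WA WB), wiringEvent_rel WA WB⟩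

variable (WA : WiringA s t) (WB : WiringB s t)

theorem wiringHom_E (x : t.X) (a : t.A) :
    wiringHom WA WB (E x a) = effective (fun _ => E) (WA x) a := by
  simp [wiringHom, E, wiringEvent]

theorem wiringHom_F (y : t.Y) (b : t.B) :
    wiringHom WA WB (F y b) = effective (fun _ => F) (WB y) b := by
  simp [wiringHom, F, wiringEvent]

theorem tensorAdj_effective {In Out : Fin n → Type} [∀ i, Fintype (Out i)] {R : Type}
    [DecidableEq R] (p : ∀ i, In i → Out i → SymAlg (s i)) (hp : ∀ i x a, adj (p i x a) = p i x a)
    {S : Finset (Fin n)} (σ : Strategy In Out R S) (r : R) :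
    tensorAdj (effective p σ r) = effective p σ r := by
  rw [effective, Strategy.map_sumRuns]
  refine Strategy.sumRuns_congr _ fun α r' _ => ?_
  split_ifs
  · rw [tensorAdj_tprod]
    congr 1
    funext i
    rcases α i with _ | ⟨x, a⟩
    · exact adj_one
    · exact hp i x a
  · exact map_zero _

theorem wiringHom_adj (f : SymAlg t) : wiringHom WA WB (adj f) = tensorAdj (wiringHom WA WB f) := by
  let N : Subalgebra ℝ (SymAlg t) :=
    { carrier := {f | wiringHom WA WB (adj f) = tensorAdj (wiringHom WA WB f)}
      mul_mem' := fun {f g} hf hg => by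
        simp only [Set.mem_ofPred_eq] at hf hg ⊢
        rw [adj_mul, map_mul, map_mul, tensorAdj_mul, hf, hg]
      add_mem' := fun {f g} hf hg => by
        simp only [Set.mem_ofPred_eq] at hf hg ⊢
        rw [map_add, map_add, map_add, map_add, hf, hg]
      algebraMap_mem' := fun r => by
        simp only [Set.mem_ofPred_eq]
        rw [adj_algebraMap, AlgHom.commutes, Algebra.algebraMap_eq_smul_one, map_smul,
          PiTensorProduct.one_def, tensorAdj_tprod]
        simp only [Pi.one_apply, adj_one]
        rfl }
  refine mem_of_symbols_mem N (fun x a => ?_) (fun y b => ?_) f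
  · change wiringHom WA WB (adj _) = _
    rw [adj_E, wiringHom_E, tensorAdj_effective _ fun _ => adj_E]
  · change wiringHom WA WB (adj _) = _
    rw [adj_F, wiringHom_F, tensorAdj_effective _ fun _ => adj_F]

/-- A wiring uses each box at most once, so it maps products of degree `(m, n)` to combinations of
tensors all of whose factors have degree at most `(m, n)`. -/
theorem wiringHom_mem_tensorSpan {k l : ℕ} {w : SymAlg t} (hw : w ∈ opsAB t k l) :
    wiringHom WA WB w ∈ tensorSpan fun i => opsAB (s i) k l := by
  obtain ⟨u, v, hu, hv, rfl⟩ := hw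
  have hA : wiringHom WA WB (u.map fun p => E p.1 p.2).prod ∈
      tensorSpan fun i => opsAB (s i) u.length 0 := by
    clear hu
    induction u with
    | nil =>
      rw [List.map_nil, List.prod_nil, map_one]
      exact tprod_mem_tensorSpan fun i => one_mem_opsAB 0 0
    | cons p u ih =>
      rw [List.map_cons, List.prod_cons, map_mul, wiringHom_E]
      refine mul_mem_tensorSpan (T := fun i => opsAB (s i) 1 0) (fun i f hf g hg => ?_)
        (effective_mem_tensorSpan _ (fun _ => one_mem_opsAB _ _) (fun _ => E_mem_opsAB) _ _) ih
      rw [List.length_cons, add_comm]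
      exact mul_mem_opsAB hf hg
  have hB : wiringHom WA WB (v.map fun p => F p.1 p.2).prod ∈
      tensorSpan fun i => opsAB (s i) 0 v.length := by
    clear hv
    induction v with
    | nil =>
      rw [List.map_nil, List.prod_nil, map_one]
      exact tprod_mem_tensorSpan fun i => one_mem_opsAB 0 0
    | cons p v ih =>
      rw [List.map_cons, List.prod_cons, map_mul, wiringHom_F]
      refine mul_mem_tensorSpan (T := fun i => opsAB (s i) 0 1) (fun i f hf g hg => ?_)
        (effective_mem_tensorSpan _ (fun _ => one_mem_opsAB _ _) (fun _ => F_mem_opsAB) _ _) ih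
      rw [List.length_cons, add_comm]
      exact mul_mem_opsAB hf hg
  rw [map_mul]
  refine mul_mem_tensorSpan (fun i f hf g hg => ?_) hA hB
  exact opsAB_mono (by omega) (by omega) (mul_mem_opsAB hf hg)

theorem wiringHom_mem_of_mem_bar {O : OperatorSet} {f : SymAlg t} (hf : f ∈ O.bar t) :
    wiringHom WA WB f ∈ tensorSpan fun i => O.ops (s i) := by
  have h : O.bar t ≤ (tensorSpan fun i => O.ops (s i)).comap (wiringHom WA WB).toLinearMap := by
    refine Submodule.span_le.2 fun w hw => ?_
    simp only [OperatorSet.ops, Set.mem_iUnion] at hw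
    obtain ⟨p, hp, hw⟩ := hw
    exact tensorSpan_mono (fun i => Set.subset_biUnion_of_mem (u := fun p : ℕ × ℕ =>
      opsAB (s i) p.1 p.2) hp) (wiringHom_mem_tensorSpan WA WB hw)
  exact h hf

/-- The tensor product of states, evaluated on a pair of effective projectors, is the wired box. -/
theorem tensorState_wiringHom {P : (i : Fin n) → Table (s i)} {Λ : ∀ i, SymAlg (s i) →ₗ[ℝ] ℝ}
    (hΛ : ∀ i o o', Λ i (recorded E o * recorded F o') = (P i).prob o o')
    (x : t.X) (y : t.Y) (a : t.A) (b : t.B) :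
    tensorState Λ (wiringHom WA WB (E x a * F y b)) = wire P WA WB x y a b := by
  rw [map_mul, wiringHom_E, wiringHom_F, wire]
  have h1 := Strategy.map_sumRuns (WA x) ((tensorState Λ).toAddMonoidHom.comp
    (AddMonoidHom.mulRight (effective (fun i => F (s := s i)) (WB y) b)))
    (fun α r' => if r' = a then PiTensorProduct.tprod ℝ fun i =>
      recorded (E (s := s i)) (α i) else 0)
  refine h1.trans (Strategy.sumRuns_congr _ fun α a' _ => ?_)
  have h2 := Strategy.map_sumRuns (WB y) ((tensorState Λ).toAddMonoidHom.comp
    (AddMonoidHom.mulLeft (if a' = a then PiTensorProduct.tprod ℝ fun i =>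
      recorded (E (s := s i)) (α i) else 0)))
    (fun α r' => if r' = b then PiTensorProduct.tprod ℝ fun i =>
      recorded (F (s := s i)) (α i) else 0)
  refine h2.trans (Strategy.sumRuns_congr _ fun β b' _ => ?_)
  by_cases ha : a' = a <;> by_cases hb : b' = b <;>
    simp [ha, hb, PiTensorProduct.tprod_mul_tprod, tensorState_tprod, hΛ]

end Wiring

/-! ### The wired box is no-signalling -/

section NoSignalling

theorem IsNoSignalling.prob_nonneg {s : Scenario} {P : Table s} (h : IsNoSignalling P)
    (o : Option (s.X × s.A)) (o' : Option (s.Y × s.B)) : 0 ≤ P.prob o o' := by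
  rcases o with _ | ⟨x, a⟩ <;> rcases o' with _ | ⟨y, b⟩
  · exact zero_le_one
  · exact Finset.sum_nonneg fun _ _ => h.nonneg _ _ _ _
  · exact Finset.sum_nonneg fun _ _ => h.nonneg _ _ _ _
  · exact h.nonneg _ _ _ _

theorem IsNoSignalling.sum_prob_alice {s : Scenario} {P : Table s} (h : IsNoSignalling P) (x : s.X)
    (o' : Option (s.Y × s.B)) : ∑ a, P.prob (some (x, a)) o' = P.prob none o' := by
  rcases o' with _ | ⟨y, b⟩
  · exact h.sum_eq_one _ _
  · exact h.bob _ _ _ _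

theorem IsNoSignalling.sum_prob_bob {s : Scenario} {P : Table s} (h : IsNoSignalling P) (y : s.Y)
    (o : Option (s.X × s.A)) : ∑ b, P.prob o (some (y, b)) = P.prob o none := by
  rcases o with _ | ⟨x, a⟩
  · exact (Finset.sum_comm).trans (h.sum_eq_one _ _)
  · exact h.alice _ _ _ _

variable {n : ℕ} {s : Fin n → Scenario} {t : Scenario} {P : (i : Fin n) → Table (s i)}

theorem sum_wire_bob (hP : ∀ i, IsNoSignalling (P i)) (WA : WiringA s t) (WB : WiringB s t)
    (x : t.X) (y : t.Y) (a : t.A) : ∑ b, wire P WA WB x y a b =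
      (WA x).sumRuns fun α a' => if a' = a then ∏ i, (P i).prob (α i) none else 0 := by
  simp only [wire]
  rw [Strategy.sum_sumRuns]
  refine Strategy.sumRuns_congr _ fun α a' _ => ?_
  rw [Strategy.sum_sumRuns]
  split_ifs with h
  · rw [← (WB y).sumRuns_prod (fun i => (P i).prob (α i)) fun i _ y => (hP i).sum_prob_bob y _]
    exact Strategy.sumRuns_congr _ fun β b' _ => by simp [h]
  · simp only [h, false_and, if_false, Finset.sum_const_zero]
    exact (Strategy.map_sumRuns (WB y) (0 : ℝ →+ ℝ) fun _ _ => 0).symm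

theorem sum_wire_alice (hP : ∀ i, IsNoSignalling (P i)) (WA : WiringA s t) (WB : WiringB s t)
    (x : t.X) (y : t.Y) (b : t.B) : ∑ a, wire P WA WB x y a b =
      (WB y).sumRuns fun β b' => if b' = b then ∏ i, (P i).prob none (β i) else 0 := by
  simp only [wire]
  rw [Strategy.sum_sumRuns]
  refine Eq.trans (Strategy.sumRuns_congr (WA x) (g' := fun α a' => (WB y).sumRuns fun β b' =>
    if b' = b then ∏ i, (P i).prob (α i) (β i) else 0) fun α a' _ => ?_) ?_
  · rw [Strategy.sum_sumRuns]
    refine Strategy.sumRuns_congr _ fun β b' _ => ?_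
    by_cases h : b' = b <;> simp [h]
  · rw [Strategy.sumRuns_comm]
    refine Strategy.sumRuns_congr _ fun β b' _ => ?_
    split_ifs with h
    · exact (WA x).sumRuns_prod (fun i o => (P i).prob o (β i)) fun i _ x =>
        (hP i).sum_prob_alice x _
    · exact (Strategy.map_sumRuns (WA x) (0 : ℝ →+ ℝ) fun _ _ => 0).symm

theorem isNoSignalling_wire (hP : ∀ i, IsNoSignalling (P i)) (WA : WiringA s t)
    (WB : WiringB s t) : IsNoSignalling (wire P WA WB) where
  nonneg x y a b := Strategy.sumRuns_nonneg _ fun α a' => Strategy.sumRuns_nonneg _ fun β b' => by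
    split_ifs
    · exact Finset.prod_nonneg fun i _ => (hP i).prob_nonneg _ _
    · exact le_rfl
  sum_eq_one x y := by
    simp only [sum_wire_bob hP]
    rw [Strategy.sum_sumRuns]
    simp only [Finset.sum_ite_eq, Finset.mem_univ, if_true]
    rw [(WA x).sumRuns_prod (fun i o => (P i).prob o none) fun i _ x => (hP i).sum_prob_alice x _]
    exact Finset.prod_eq_one fun _ _ => rfl
  alice x a y y' := by rw [sum_wire_bob hP, sum_wire_bob hP]
  bob y b x x' := by rw [sum_wire_alice hP, sum_wire_alice hP]

end NoSignalling

/-! ### Closure under wirings -/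

theorem closedUnderWirings_QO (O : OperatorSet) : ClosedUnderWirings (QO O) := by
  intro n s P hP t WA WB
  choose Λ hΛ hΛP using fun i => (hP i).exists_state
  refine ⟨isNoSignalling_wire (fun i => (hP i).1) WA WB,
    (tensorState Λ ∘ₗ (wiringHom WA WB).toLinearMap).domRestrict (O.bar2 t), ?_, fun f hf => ?_,
    fun x y a b => (tensorState_wiringHom WA WB hΛP x y a b).symm⟩
  · change tensorState Λ (wiringHom WA WB 1) = 1
    rw [map_one, PiTensorProduct.one_def, tensorState_tprod]
    exact Finset.prod_eq_one fun i _ => (hΛ i).map_one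
  · change 0 ≤ tensorState Λ (wiringHom WA WB (f * adj f))
    rw [map_mul, wiringHom_adj]
    exact tensorState_nonneg hΛ (wiringHom_mem_of_mem_bar WA WB hf)

end Wirings

theorem mainTheorem3 :
    (∀ O : Wirings.OperatorSet, Wirings.ClosedUnderWirings (Wirings.QO O)) ∧
      ∀ (N : ℕ) (hN : 1 ≤ N), Wirings.ClosedUnderWirings (Wirings.npaLevel N hN) :=
  ⟨Wirings.closedUnderWirings_QO, fun N hN =>
    Wirings.closedUnderWirings_QO (Wirings.npaOperators N hN)⟩
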